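/- Let $K = [-1,1] \cup [0,i] \subset \mathbb{C}$ be the T-shaped set (the union of the two line segments, with the topology induced from $\mathbb{C}$), let $C(K)$ be the complex Banach space of continuous functions $K \to \mathbb{C}$ with the supremum norm, let $\overline{B_{C(K)}}$ be its closed unit ball, and let $H$ be the group of all composition operators $f \mapsto f \circ \phi$ on $C(K)$, where $\phi : K \to K$ ranges over the homeomorphisms of $K$. A continuous polynomial on $C(K)$ is a function $P : C(K) \to \mathbb{C}$ of the form $P(f) = \sum_{k=0}^{n} L_k(f,\dots,f)$ with $n \in \mathbb{N}$ and $L_k$ a continuous $k$-linear form on $C(K)$; it is $H$-invariant if $P(\gamma(f)) = P(f)$ for all $\gamma \in H$ and $f \in C(K)$; and it separates $g \in C(K)$ from $\overline{B_{C(K)}}$ if $\sup_{f \in \overline{B_{C(K)}}} |P(f)| < |P(g)|$. Let $g \in C(K) \setminus \overline{B_{C(K)}}$. Then $g$ can be separated from $\overline{B_{C(K)}}$ by an $H$-invariant continuous polynomial if and only if $$\max\{|g(0)|, |g(1)|, |g(-1)|, |g(i)|\} > 1.$$ -/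

import Mathlib

namespace InvariantPolynomials

section Polynomials

variable {X : Type*} [NormedAddCommGroup X] [NormedSpace ℂ X]

/-- A continuous polynomial on `X`: a finite sum of continuous homogeneous polynomials, the
`k`-homogeneous ones being the diagonal restrictions of continuous `k`-linear forms. -/
def IsContinuousPolynomial (P : X → ℂ) : Prop :=
  ∃ (n : ℕ) (L : (k : ℕ) → ContinuousMultilinearMap ℂ (fun _ : Fin k => X) ℂ),
    ∀ x, P x = ∑ k ∈ Finset.range (n + 1), L k (fun _ => x)

/-- `P` is invariant under the group `G` of invertible continuous linear operators on `X`. -/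
def IsInvariant (G : Subgroup (X ≃L[ℂ] X)) (P : X → ℂ) : Prop :=
  ∀ γ ∈ G, ∀ x, P (γ x) = P x

/-- `P` separates the point `z` from the set `A`: `sup_{w ∈ A} |P w| < |P z|`, where the supremum
is taken in `[0, ∞]`. -/
def Separates (P : X → ℂ) (z : X) (A : Set X) : Prop :=
  (⨆ w ∈ A, ‖P w‖ₑ) < ‖P z‖ₑ

end Polynomials

section Composition

variable (K : Type*) [TopologicalSpace K] [CompactSpace K]

/-- The composition operator `f ↦ f ∘ φ` on `C(K)` given by a homeomorphism `φ` of `K`. -/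
noncomputable def compositionOperator (φ : K ≃ₜ K) : C(K, ℂ) ≃L[ℂ] C(K, ℂ) where
  toFun f := f.comp (φ : C(K, K))
  invFun f := f.comp (φ.symm : C(K, K))
  map_add' _ _ := rfl
  map_smul' _ _ := rfl
  left_inv f := by ext x; simp
  right_inv f := by ext x; simp
  continuous_toFun := ContinuousMap.continuous_precomp _
  continuous_invFun := ContinuousMap.continuous_precomp _

/-- The group `H` of all composition operators on `C(K)` by homeomorphisms of `K`. -/
noncomputable def compositionGroup : Subgroup (C(K, ℂ) ≃L[ℂ] C(K, ℂ)) where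
  carrier := {γ | ∃ φ : K ≃ₜ K, γ = compositionOperator K φ}
  one_mem' := ⟨Homeomorph.refl K, by ext f x; rfl⟩
  mul_mem' := by
    rintro _ _ ⟨φ, rfl⟩ ⟨ψ, rfl⟩
    exact ⟨φ.trans ψ, by ext f x; rfl⟩
  inv_mem' := by
    rintro _ ⟨φ, rfl⟩
    exact ⟨φ.symm, by ext f x; rfl⟩

end Composition

/-- The T-shape set `[-1, 1] ∪ [0, i]` in the complex plane. -/
def tShape : Set ℂ := segment ℝ (-1) 1 ∪ segment ℝ 0 Complex.I

theorem isCompact_tShape : IsCompact tShape := by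
  have h : ∀ a b : ℂ, IsCompact (segment ℝ a b) := fun a b => by
    rw [segment_eq_image_lineMap]
    exact isCompact_Icc.image AffineMap.lineMap_continuous
  exact (h _ _).union (h _ _)

instance : CompactSpace tShape := isCompact_iff_compactSpace.mp isCompact_tShape

theorem zero_mem_tShape : (0 : ℂ) ∈ tShape := Or.inr (left_mem_segment ℝ _ _)

theorem one_mem_tShape : (1 : ℂ) ∈ tShape := Or.inl (right_mem_segment ℝ _ _)

theorem neg_one_mem_tShape : (-1 : ℂ) ∈ tShape := Or.inl (left_mem_segment ℝ _ _)

theorem I_mem_tShape : Complex.I ∈ tShape := Or.inr (right_mem_segment ℝ _ _)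

end InvariantPolynomials

/-! Homeomorphisms of the T-shape fix the centre and permute the three leg ends, because
connectedness of the complement distinguishes these points (`homeomorph_zero`,
`homeomorph_isLegEnd`). If `g` exceeds 1 in modulus at one of them, a power sum of point evaluations
over the invariant set `{0}` or over the three ends separates: it is at most the cardinality on the
ball, while at `g` some exponent makes it larger (`exists_card_lt_norm_sum_pow`).

Conversely, an invariant polynomial `P` is blind to the values inside a leg. Suppose `v` is constant
on part of a leg and `d` is a bump there. Sliding `d` along by iterates of a homeomorphism that
preserves `v` gives disjointly supported copies, indistinguishable to `P` around `v`. Disjoint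
supports keep all their sums with coefficients of modulus at most 1 bounded, which forces each
positive-degree homogeneous part at `v` to vanish on `d` (`diag_eq_zero_of_bounded`). Hence `P (v +
d) = P v` (`eq_of_bump`). Two such perturbations compare functions that are flat near the ends of a
leg (`eq_of_flat`), and continuity removes the flatness (`eq_of_eq_off_leg`). If `g` is bounded by 1
at the four points, affine interpolation on the legs therefore gives a function in the ball with the
same value under every such `P`. -/

namespace InvariantPolynomials
open Finset Filter Topology

/-! ### Homogeneous polynomials on sequences with bounded sums -/

section Homogeneous

variable {X : Type*} [NormedAddCommGroup X] [NormedSpace ℂ X]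

theorem diag_smul {k : ℕ} (B : ContinuousMultilinearMap ℂ (fun _ : Fin k => X) ℂ) (t : ℂ) (x : X) :
    B (fun _ => t • x) = t ^ k * B (fun _ => x) := by
  have := B.map_smul_univ (fun _ => t) (fun _ => x)
  simpa using this

/-- Averaging a homogeneous polynomial of degree `k` over the `k`-th roots of unity in one
direction. -/
theorem sum_diag_add_rootsOfUnity {k : ℕ} (hk : 0 < k) {ζ : ℂ} (hζ : IsPrimitiveRoot ζ k)
    (B : ContinuousMultilinearMap ℂ (fun _ : Fin k => X) ℂ) (x d : X) :
    ∑ j ∈ range k, B (fun _ => ζ ^ j • d + x) = k * (B (fun _ => x) + B (fun _ => d)) := by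
  have expand : ∀ c : ℂ, B (fun _ => c • d + x) =
      ∑ s : Finset (Fin k), c ^ s.card * B (s.piecewise (fun _ => d) (fun _ => x)) := by
    intro c
    have h := B.toMultilinearMap.map_add_univ (fun _ => c • d) (fun _ => x)
    refine Eq.trans h (sum_congr rfl fun s _ => ?_)
    have h2 := B.toMultilinearMap.map_piecewise_smul (fun _ => c)
      (s.piecewise (fun _ => d) (fun _ => x)) s
    rw [prod_const, smul_eq_mul] at h2
    refine Eq.trans ?_ h2
    congr 1
    ext i
    by_cases hi : i ∈ s <;> simp [hi]
  -- Orthogonality of roots of unity: in degrees `0` to `k` only the two extremes survive, so the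
  -- mixed terms of the expansion average out.
  have hsum : ∀ m : ℕ, m ≤ k → ∑ j ∈ range k, (ζ ^ j) ^ m =
      if m = 0 ∨ m = k then (k : ℂ) else 0 := by
    intro m hm
    simp_rw [← pow_mul, mul_comm _ m, pow_mul]
    split_ifs with h
    · rcases h with rfl | rfl
      · simp
      · simp [hζ.pow_eq_one]
    · push Not at h
      have h1 : ζ ^ m ≠ 1 := hζ.pow_ne_one_of_pos_of_lt h.1 (lt_of_le_of_ne hm h.2)
      rw [geom_sum_eq h1, ← pow_mul, mul_comm, pow_mul, hζ.pow_eq_one]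
      simp
  simp_rw [expand]
  rw [sum_comm]
  simp_rw [← sum_mul]
  have hne : (∅ : Finset (Fin k)) ≠ univ := by
    have : Nonempty (Fin k) := ⟨⟨0, hk⟩⟩
    exact univ_nonempty.ne_empty.symm
  rw [← sum_subset (subset_univ ({∅, univ} : Finset (Finset (Fin k))))]
  · rw [sum_pair hne, hsum _ (by simp), hsum _ (by simp)]
    simp
    ring
  · intro s _ hs
    have hc : s.card ≤ k := by simpa using card_le_univ s
    rw [hsum _ hc, if_neg, zero_mul]
    rintro (h | h)
    · exact hs (by simp [card_eq_zero.mp h])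
    · exact hs (by simp [(card_eq_iff_eq_univ s).mp (by simpa using h)])

/-- An average is bounded in norm by one of its terms, so each new vector can be absorbed with a
suitable root of unity as coefficient. The constant `c` is general so that the induction can store
the value at the last vector in it. -/
theorem exists_le_norm_add_diag_sum {k : ℕ} (hk : 0 < k)
    (B : ContinuousMultilinearMap ℂ (fun _ : Fin k => X) ℂ) (d : ℕ → X) (N : ℕ) (c : ℂ) :
    ∃ s : ℕ → ℂ, (∀ i, ‖s i‖ ≤ 1) ∧
      ‖c + ∑ i ∈ range N, B (fun _ => d i)‖ ≤ ‖c + B (fun _ => ∑ i ∈ range N, s i • d i)‖ := by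
  induction N generalizing c with
  | zero =>
    refine ⟨0, by simp, ?_⟩
    have := diag_smul B 0 0
    rw [zero_pow hk.ne', zero_mul, smul_zero] at this
    simp [this]
  | succ N ih =>
    obtain ⟨s, hs, h⟩ := ih (c + B (fun _ => d N))
    set x := ∑ i ∈ range N, s i • d i
    obtain ⟨ζ, hζ⟩ : ∃ ζ : ℂ, IsPrimitiveRoot ζ k := ⟨_, Complex.isPrimitiveRoot_exp k hk.ne'⟩
    obtain ⟨j, hj⟩ : ∃ j : ℕ, ‖c + B (fun _ => d N) + B (fun _ => x)‖ ≤
        ‖c + B (fun _ => ζ ^ j • d N + x)‖ := by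
      by_contra! hlt
      have h1 : ‖∑ j ∈ range k, (c + B (fun _ => ζ ^ j • d N + x))‖ <
          k * ‖c + B (fun _ => d N) + B (fun _ => x)‖ := by
        refine (norm_sum_le _ _).trans_lt ?_
        calc _ < ∑ j ∈ range k, ‖c + B (fun _ => d N) + B (fun _ => x)‖ :=
              sum_lt_sum_of_nonempty (by simpa using hk.ne') fun j _ => hlt j
          _ = _ := by simp
      rw [sum_add_distrib, sum_diag_add_rootsOfUnity hk hζ] at h1
      have h2 : ∑ _j ∈ range k, c + (k : ℂ) * (B (fun _ => x) + B (fun _ => d N)) =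
          k * (c + B (fun _ => d N) + B (fun _ => x)) := by
        simp; ring
      rw [h2, norm_mul] at h1
      simp at h1
    refine ⟨fun i => if i = N then ζ ^ j else s i, fun i => ?_, ?_⟩
    · dsimp only
      split_ifs
      · rw [norm_pow, hζ.norm'_eq_one hk.ne', one_pow]
      · exact hs i
    · have hx : ∑ i ∈ range (N + 1), (if i = N then ζ ^ j else s i) • d i = ζ ^ j • d N + x := by
        rw [sum_range_succ, if_pos rfl, add_comm]
        congr 1
        refine sum_congr rfl fun i hi => ?_
        rw [if_neg (mem_range.mp hi).ne]
      rw [hx, sum_range_succ, add_comm (∑ i ∈ range N, _), ← add_assoc]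
      exact h.trans hj

/-- A homogeneous polynomial of positive degree that takes the same value at all the vectors of a
sequence with bounded unimodular sums vanishes at these vectors. -/
theorem diag_eq_zero_of_bounded {k : ℕ} (hk : 0 < k)
    (B : ContinuousMultilinearMap ℂ (fun _ : Fin k => X) ℂ) (d : ℕ → X) (C : ℝ)
    (hC : ∀ (N : ℕ) (s : ℕ → ℂ), (∀ i, ‖s i‖ ≤ 1) → ‖∑ i ∈ range N, s i • d i‖ ≤ C)
    (q : ℂ) (hq : ∀ i, B (fun _ => d i) = q) : q = 0 := by
  by_contra hne
  have hpos : 0 < ‖q‖ := norm_pos_iff.mpr hne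
  obtain ⟨N, hN⟩ := exists_nat_gt (‖B‖ * C ^ k / ‖q‖)
  obtain ⟨s, hs, h⟩ := exists_le_norm_add_diag_sum hk B d N 0
  have h1 : ‖B (fun _ => ∑ i ∈ range N, s i • d i)‖ ≤ ‖B‖ * C ^ k := by
    refine (B.le_opNorm _).trans ?_
    rw [prod_const, card_univ, Fintype.card_fin]
    gcongr
    exact hC N s hs
  simp only [hq, zero_add, sum_const, card_range, nsmul_eq_mul, norm_mul, Complex.norm_natCast] at h
  rw [div_lt_iff₀ hpos] at hN
  linarith

end Homogeneous

/-! ### Recentring polynomials and comparing Taylor coefficients -/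

section Polynomials

variable {X : Type*} [NormedAddCommGroup X] [NormedSpace ℂ X]

theorem IsContinuousPolynomial.continuous {P : X → ℂ} (hP : IsContinuousPolynomial P) :
    Continuous P := by
  obtain ⟨n, L, h⟩ := hP
  rw [funext h]
  exact continuous_finsetSum _ fun k _ => (L k).cont.comp (by fun_prop)

theorem IsContinuousPolynomial.comp_add_left {P : X → ℂ} (hP : IsContinuousPolynomial P) (v : X) :
    IsContinuousPolynomial fun x => P (v + x) := by
  obtain ⟨n, L, h⟩ := hP
  -- The forms `L k` with `k > n` are arbitrary; truncation makes the power series finite, and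
  -- change of origin then keeps the degree bound.
  let p : FormalMultilinearSeries ℂ X ℂ := fun k => if k < n + 1 then L k else 0
  have hp : HasFiniteFPowerSeriesOnBall P p 0 (n + 1) ⊤ := by
    refine HasFiniteFPowerSeriesOnBall.mk' (fun m hm => if_neg hm.not_gt) (by simp) fun y _ => ?_
    rw [zero_add, h]
    exact sum_congr rfl fun k hk => by rw [show p k = L k from if_pos (mem_range.mp hk)]
  have h2 := hp.changeOrigin (y := v) (by simp)
  refine ⟨n, p.changeOrigin v, fun x => ?_⟩
  have h3 := h2.eq_partialSum x (by simp) (n + 1) le_rfl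
  rwa [zero_add] at h3

/-- If `P` does not distinguish the points `v + t d i` for different `i`, and the vectors `d i`
have bounded unimodular sums, then `P` does not distinguish them from `v`. -/
theorem IsContinuousPolynomial.eq_of_bounded {P : X → ℂ} (hP : IsContinuousPolynomial P) (v : X)
    (d : ℕ → X) (C : ℝ)
    (hC : ∀ (N : ℕ) (s : ℕ → ℂ), (∀ i, ‖s i‖ ≤ 1) → ‖∑ i ∈ range N, s i • d i‖ ≤ C)
    (h : ∀ i (t : ℂ), P (v + t • d i) = P (v + t • d 0)) : P (v + d 0) = P v := by
  obtain ⟨n, L, hL⟩ := hP.comp_add_left v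
  replace hL : ∀ x, P (v + x) = ∑ k ∈ range (n + 1), L k fun _ => x := hL
  -- Restricting to the line `v + t • d i` turns equality of values for all `t` into equality of
  -- coefficients, degree by degree.
  let poly : ℕ → Polynomial ℂ := fun i =>
    ∑ k ∈ range (n + 1), Polynomial.C (L k fun _ => d i) * Polynomial.X ^ k
  have heval : ∀ i t, (poly i).eval t = P (v + t • d i) := by
    intro i t
    rw [hL]
    simp only [poly, Polynomial.eval_finsetSum]
    refine sum_congr rfl fun k _ => ?_
    rw [diag_smul, Polynomial.eval_mul, Polynomial.eval_C, Polynomial.eval_pow, Polynomial.eval_X,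
      mul_comm]
  have hcoeff : ∀ i, ∀ k ∈ range (n + 1), (poly i).coeff k = L k fun _ => d i := by
    intro i k hk
    simp only [poly, Polynomial.finsetSum_coeff, Polynomial.coeff_C_mul_X_pow]
    rw [sum_ite_eq, if_pos hk]
  have hpoly : ∀ i, poly i = poly 0 := fun i => Polynomial.funext fun t => by
    rw [heval, heval, h]
  have hzero : ∀ k ∈ range (n + 1), 0 < k → (L k fun _ => d 0) = 0 := fun k hk hk0 =>
    diag_eq_zero_of_bounded hk0 (L k) d C hC _ fun i => by
      rw [← hcoeff i k hk, hpoly, hcoeff 0 k hk]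
  rw [hL, show P v = P (v + 0) by rw [add_zero], hL]
  refine sum_congr rfl fun k hk => ?_
  rcases Nat.eq_zero_or_pos k with rfl | hk0
  · congr 1
    exact Subsingleton.elim _ _
  · have h0 := diag_smul (L k) 0 (0 : X)
    rw [zero_pow hk0.ne', zero_mul, smul_zero] at h0
    rw [hzero k hk hk0, h0]

end Polynomials

/-! ### Growth of power sums -/

section PowerSums

theorem exists_card_lt_norm_sum_pow {ι : Type*} (S : Finset ι) (a : ι → ℂ) {i₀ : ι} (hi₀ : i₀ ∈ S)
    (h1 : 1 < ‖a i₀‖) : ∃ n : ℕ, (S.card : ℝ) < ‖∑ i ∈ S, a i ^ n‖ := by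
  classical
  by_contra! hb
  -- `q` kills every value except `a i₀`. Weighting by it combines boundedly many power sums into a
  -- nonzero multiple of `a i₀ ^ n`, which is unbounded in `n`, so cancellation cannot persist.
  let q : Polynomial ℂ := ∏ w ∈ (S.image a).erase (a i₀), (Polynomial.X - Polynomial.C w)
  have hq0 : q.eval (a i₀) ≠ 0 := by
    simp only [q, Polynomial.eval_prod, prod_ne_zero_iff]
    intro w hw
    simpa [sub_eq_zero] using (ne_of_mem_erase hw).symm
  have hq : ∀ i ∈ S, a i ≠ a i₀ → q.eval (a i) = 0 := by
    intro i hi hne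
    simp only [q, Polynomial.eval_prod, prod_eq_zero_iff]
    exact ⟨a i, mem_erase.mpr ⟨hne, mem_image_of_mem a hi⟩, by simp⟩
  set T := S.filter (fun i => a i = a i₀)
  have hT : 1 ≤ (T.card : ℝ) := by
    exact Nat.one_le_cast.mpr (card_pos.mpr ⟨i₀, mem_filter.mpr ⟨hi₀, rfl⟩⟩)
  have hsum : ∀ n, ∑ i ∈ S, a i ^ n * q.eval (a i) = T.card * (a i₀ ^ n * q.eval (a i₀)) := by
    intro n
    rw [← sum_filter_of_ne (p := fun i => a i = a i₀)]
    · rw [sum_congr rfl (g := fun _ => a i₀ ^ n * q.eval (a i₀))]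
      · simp [T]
      · intro i hi
        rw [(mem_filter.mp hi).2]
    · intro i hi hne
      by_contra hc
      exact hne (by rw [hq i hi hc, mul_zero])
  set M := ∑ k ∈ range (q.natDegree + 1), ‖q.coeff k‖ * S.card
  have hM : ∀ n, ‖∑ i ∈ S, a i ^ n * q.eval (a i)‖ ≤ M := by
    intro n
    have : ∑ i ∈ S, a i ^ n * q.eval (a i) =
        ∑ k ∈ range (q.natDegree + 1), q.coeff k * ∑ i ∈ S, a i ^ (n + k) := by
      simp_rw [Polynomial.eval_eq_sum_range, mul_sum]
      rw [sum_comm]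
      exact sum_congr rfl fun k _ => sum_congr rfl fun i _ => by ring
    rw [this]
    refine (norm_sum_le _ _).trans (sum_le_sum fun k _ => ?_)
    rw [norm_mul]
    gcongr
    exact hb _
  obtain ⟨n, hn⟩ := pow_unbounded_of_one_lt (M / ‖q.eval (a i₀)‖) h1
  rw [div_lt_iff₀ (norm_pos_iff.mpr hq0)] at hn
  have h2 := hM n
  rw [hsum, norm_mul, norm_mul, norm_pow, Complex.norm_natCast] at h2
  have h3 : 0 ≤ ‖a i₀‖ ^ n * ‖q.eval (a i₀)‖ := by positivity
  nlinarith

end PowerSums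

/-! ### Separation by power sums of evaluations -/

section Evaluations

variable {K : Type*} [TopologicalSpace K] [CompactSpace K]

theorem isContinuousPolynomial_sum_pow (S : Finset K) (n : ℕ) :
    IsContinuousPolynomial fun f : C(K, ℂ) => ∑ z ∈ S, f z ^ n := by
  refine ⟨n, fun k => if k = n then ∑ z ∈ S,
    (ContinuousMultilinearMap.mkPiAlgebra ℂ (Fin k) ℂ).compContinuousLinearMap
      (fun _ => ContinuousMap.evalCLM ℂ z) else 0, fun f => ?_⟩
  rw [sum_eq_single_of_mem n (by simp)]
  · simp
  · intro k _ hk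
    simp [hk]

theorem exists_separating_of_invariant_finset (S : Finset K) (hS : ∀ φ : K ≃ₜ K, ∀ z ∈ S, φ z ∈ S)
    (g : C(K, ℂ)) {z₀ : K} (hz₀ : z₀ ∈ S) (hg : 1 < ‖g z₀‖) :
    ∃ P : C(K, ℂ) → ℂ, IsContinuousPolynomial P ∧ IsInvariant (compositionGroup K) P ∧
      Separates P g (Metric.closedBall 0 1) := by
  obtain ⟨n, hn⟩ := exists_card_lt_norm_sum_pow S g hz₀ hg
  refine ⟨_, isContinuousPolynomial_sum_pow S n, ?_, ?_⟩
  · rintro _ ⟨φ, rfl⟩ f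
    refine sum_bij' (fun z _ => φ z) (fun z _ => φ.symm z) (fun z hz => hS φ z hz)
      (fun z hz => hS φ.symm z hz) (by simp) (by simp) (fun z _ => rfl)
  · refine lt_of_le_of_lt (b := ENNReal.ofReal S.card) (iSup₂_le fun f hf => ?_) ?_
    · rw [← ofReal_norm]
      refine ENNReal.ofReal_le_ofReal ((norm_sum_le _ _).trans ?_)
      rw [card_eq_sum_ones, Nat.cast_sum]
      refine sum_le_sum fun z _ => ?_
      rw [norm_pow, Nat.cast_one]
      exact pow_le_one₀ (norm_nonneg _) ((f.norm_coe_le_norm z).trans (by simpa using hf))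
    · rw [← ofReal_norm]
      exact (ENNReal.ofReal_lt_ofReal_iff_of_nonneg (Nat.cast_nonneg _)).mpr hn

end Evaluations

/-! ### Coordinates on the legs -/

section Legs

/-- The coordinate along the direction `e`. -/
noncomputable def legCoord (e z : ℂ) : ℝ := e.re * z.re + e.im * z.im

theorem continuous_legCoord (e : ℂ) : Continuous (legCoord e) := by
  unfold legCoord; fun_prop

/-- The endpoints of the three legs of the T-shape. -/
def IsLegEnd (e : ℂ) : Prop := e = 1 ∨ e = -1 ∨ e = Complex.I

theorem IsLegEnd.legCoord_self_mul {e : ℂ} (he : IsLegEnd e) (t : ℝ) : legCoord e (t * e) = t := by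
  rcases he with rfl | rfl | rfl <;> simp [legCoord]

theorem IsLegEnd.legCoord_self {e : ℂ} (he : IsLegEnd e) : legCoord e e = 1 := by
  simpa using he.legCoord_self_mul 1

theorem IsLegEnd.legCoord_add_mul {e : ℂ} (he : IsLegEnd e) (z : ℂ) (t : ℝ) :
    legCoord e (z + t * e) = legCoord e z + t := by
  rcases he with rfl | rfl | rfl <;> (simp [legCoord]; try ring)

theorem legCoord_zero (e : ℂ) : legCoord e 0 = 0 := by simp [legCoord]

theorem IsLegEnd.legCoord_nonpos {e e' : ℂ} (he : IsLegEnd e) (he' : IsLegEnd e') (h : e ≠ e')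
    {t : ℝ} (ht : 0 ≤ t) : legCoord e (t * e') ≤ 0 := by
  rcases he with rfl | rfl | rfl <;> rcases he' with rfl | rfl | rfl <;>
    simp_all [legCoord]

theorem mem_tShape_iff {z : ℂ} :
    z ∈ tShape ↔ ∃ e, IsLegEnd e ∧ ∃ t : ℝ, 0 ≤ t ∧ t ≤ 1 ∧ z = t * e := by
  constructor
  · rintro (h | h)
    · rw [segment_eq_image] at h
      obtain ⟨s, ⟨h0, h1⟩, rfl⟩ := h
      rcases le_total s (1 / 2) with hs | hs
      · exact ⟨-1, Or.inr (Or.inl rfl), 1 - 2 * s, by linarith, by linarith, by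
          simp; ring⟩
      · exact ⟨1, Or.inl rfl, 2 * s - 1, by linarith, by linarith, by
          simp; ring⟩
    · rw [segment_eq_image] at h
      obtain ⟨s, ⟨h0, h1⟩, rfl⟩ := h
      exact ⟨Complex.I, Or.inr (Or.inr rfl), s, h0, h1, by simp⟩
  · rintro ⟨e, rfl | rfl | rfl, t, h0, h1, rfl⟩
    · left
      rw [segment_eq_image]
      exact ⟨(1 + t) / 2, ⟨by linarith, by linarith⟩, by simp; ring⟩
    · left
      rw [segment_eq_image]
      exact ⟨(1 - t) / 2, ⟨by linarith, by linarith⟩, by simp; ring⟩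
    · right
      rw [segment_eq_image]
      exact ⟨t, ⟨h0, h1⟩, by simp⟩

theorem IsLegEnd.mul_mem {e : ℂ} (he : IsLegEnd e) {t : ℝ} (h0 : 0 ≤ t) (h1 : t ≤ 1) :
    (t * e : ℂ) ∈ tShape := mem_tShape_iff.mpr ⟨e, he, t, h0, h1, rfl⟩

theorem IsLegEnd.mem {e : ℂ} (he : IsLegEnd e) : e ∈ tShape := by
  simpa using he.mul_mem zero_le_one le_rfl

theorem IsLegEnd.eq_mul_of_pos {e z : ℂ} (he : IsLegEnd e) (hz : z ∈ tShape)
    (h : 0 < legCoord e z) : z = legCoord e z * e := by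
  obtain ⟨e', he', t, h0, h1, rfl⟩ := mem_tShape_iff.mp hz
  by_cases hee : e = e'
  · subst hee
    rw [he.legCoord_self_mul]
  · exact absurd (he.legCoord_nonpos he' hee h0) (not_le.mpr h)

theorem IsLegEnd.legCoord_le_one {e z : ℂ} (he : IsLegEnd e) (hz : z ∈ tShape) :
    legCoord e z ≤ 1 := by
  obtain ⟨e', he', t, h0, h1, rfl⟩ := mem_tShape_iff.mp hz
  by_cases hee : e = e'
  · subst hee
    rwa [he.legCoord_self_mul]
  · exact (he.legCoord_nonpos he' hee h0).trans zero_le_one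

/-- `z` lies on at most one open leg. -/
theorem IsLegEnd.eq_of_pos {e e' z : ℂ} (he : IsLegEnd e) (he' : IsLegEnd e') (hz : z ∈ tShape)
    (h : 0 < legCoord e z) (h' : 0 < legCoord e' z) : e = e' := by
  by_contra hne
  rw [he.eq_mul_of_pos hz h] at h'
  exact absurd (he'.legCoord_nonpos he (Ne.symm hne) h.le) (not_le.mpr h')

theorem exists_legCoord_pos {z : ℂ} (hz : z ∈ tShape) (h0 : z ≠ 0) :
    ∃ e, IsLegEnd e ∧ 0 < legCoord e z := by
  obtain ⟨e, he, t, ht, -, rfl⟩ := mem_tShape_iff.mp hz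
  refine ⟨e, he, ?_⟩
  rw [he.legCoord_self_mul]
  exact lt_of_le_of_ne ht fun h => h0 (by simp [← h])

end Legs

/-! ### Topological characterization of the centre and the ends -/

section Homeomorphisms

theorem isPreconnected_of_image_val {s : Set tShape} (h : IsPreconnected (Subtype.val '' s)) :
    IsPreconnected s :=
  Topology.IsInducing.subtypeVal.isPreconnected_image.mp h

/-- The set is star-shaped about the centre, since `legCoord e` is linear and `t` is positive. -/
theorem isPreconnected_legCoord_lt (e : ℂ) {t : ℝ} (ht : 0 < t) :
    IsPreconnected {z : tShape | legCoord e z < t} := by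
  apply isPreconnected_of_image_val
  have hstar : StarConvex ℝ (0 : ℂ) (Subtype.val '' {z : tShape | legCoord e z < t}) := by
    rw [starConvex_zero_iff]
    rintro _ ⟨z, hz, rfl⟩ a ha0 ha1
    obtain ⟨e', he', s, h0, h1, hzs⟩ := mem_tShape_iff.mp z.2
    have hmem : a • (z : ℂ) ∈ tShape := by
      rw [hzs, Complex.real_smul, ← mul_assoc, ← Complex.ofReal_mul]
      exact he'.mul_mem (by positivity) (mul_le_one₀ ha1 h0 h1)
    refine ⟨⟨_, hmem⟩, ?_, rfl⟩
    have hz' : legCoord e z < t := hz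
    have : legCoord e (a • (z : ℂ)) = a * legCoord e z := by simp [legCoord]; ring
    change legCoord e (a • (z : ℂ)) < t
    rw [this]
    rcases le_total (legCoord e z) 0 with h | h
    · exact (mul_nonpos_of_nonneg_of_nonpos ha0 h).trans_lt ht
    · exact (mul_le_of_le_one_left h ha1).trans_lt hz'
  exact (hstar.isPathConnected ⟨⟨0, zero_mem_tShape⟩, by simpa [legCoord_zero] using ht,
    rfl⟩).isConnected.isPreconnected

theorem IsLegEnd.isPreconnected_gt {e : ℂ} (he : IsLegEnd e) {t : ℝ} (ht : 0 < t) :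
    IsPreconnected {z : tShape | t < legCoord e z} := by
  apply isPreconnected_of_image_val
  have : Subtype.val '' {z : tShape | t < legCoord e z} = (fun s : ℝ => (s * e : ℂ)) '' Set.Ioc t 1 := by
    ext w
    constructor
    · rintro ⟨z, hz, rfl⟩
      exact ⟨legCoord e z, ⟨hz, he.legCoord_le_one z.2⟩,
        (he.eq_mul_of_pos z.2 (ht.trans hz)).symm⟩
    · rintro ⟨s, hs, rfl⟩
      refine ⟨⟨_, he.mul_mem (ht.trans hs.1).le hs.2⟩, ?_, rfl⟩
      simpa [he.legCoord_self_mul] using hs.1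
  rw [this]
  exact isPreconnected_Ioc.image _ (by fun_prop)

theorem IsLegEnd.compl_singleton {e : ℂ} (he : IsLegEnd e) (z : tShape) (hz : 0 < legCoord e z) :
    ({z}ᶜ : Set tShape) =
      {w : tShape | legCoord e w < legCoord e z} ∪ {w : tShape | legCoord e z < legCoord e w} := by
  ext w
  simp only [Set.mem_compl_iff, Set.mem_singleton_iff, Set.mem_union, Set.mem_ofPred_eq,
    ← ne_iff_lt_or_gt, ne_eq, not_iff_not]
  refine ⟨fun h => by rw [h], fun h => Subtype.ext ?_⟩
  rw [he.eq_mul_of_pos z.2 hz, he.eq_mul_of_pos w.2 (h ▸ hz), h]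

/-- Removing the centre leaves disjoint open legs, so a preconnected set avoiding it stays in one.
With three ends and only two pieces, the pigeonhole principle then singles out the centre. -/
theorem IsLegEnd.eq_of_mem_preconnected {e e' : ℂ} (he : IsLegEnd e) (he' : IsLegEnd e')
    {A : Set tShape} (hA : IsPreconnected A) (h0 : ⟨0, zero_mem_tShape⟩ ∉ A)
    (heA : ⟨e, he.mem⟩ ∈ A) (heA' : ⟨e', he'.mem⟩ ∈ A) : e = e' := by
  by_contra hne
  let U : Set tShape := {z | 0 < legCoord e z}
  let V : Set tShape := ⋃ e'' ∈ {w | IsLegEnd w ∧ w ≠ e}, {z : tShape | 0 < legCoord e'' z}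
  have hopen : ∀ w : ℂ, IsOpen {z : tShape | 0 < legCoord w z} := fun w =>
    isOpen_lt continuous_const ((continuous_legCoord w).comp continuous_subtype_val)
  obtain ⟨z, -, hzU, hzV⟩ := hA U V (hopen e) (isOpen_biUnion fun w _ => hopen w)
    (fun z hz => by
      obtain ⟨w, hw, hpos⟩ := exists_legCoord_pos z.2 (fun h => h0 (by
        rwa [← show z = ⟨0, zero_mem_tShape⟩ from Subtype.ext h]))
      by_cases hwe : w = e
      · subst hwe; exact Or.inl hpos
      · exact Or.inr (Set.mem_biUnion (show w ∈ {w | IsLegEnd w ∧ w ≠ e} from ⟨hw, hwe⟩) hpos))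
    ⟨_, heA, by simp [U, he.legCoord_self]⟩
    ⟨_, heA', Set.mem_biUnion (show e' ∈ {w | IsLegEnd w ∧ w ≠ e} from ⟨he', Ne.symm hne⟩)
      (by simp [he'.legCoord_self])⟩
  obtain ⟨w, ⟨hw, hwe⟩, hpos⟩ := Set.mem_iUnion₂.mp hzV
  exact hwe (hw.eq_of_pos he z.2 hpos hzU)

/-- The centre is the only point whose complement is not the union of two preconnected sets. -/
theorem eq_zero_iff_not_exists_preconnected (z : tShape) :
    z = ⟨0, zero_mem_tShape⟩ ↔
      ¬ ∃ A B : Set tShape, IsPreconnected A ∧ IsPreconnected B ∧ ({z}ᶜ : Set tShape) = A ∪ B := by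
  constructor
  · rintro rfl ⟨A, B, hA, hB, hAB⟩
    have h0 : (⟨0, zero_mem_tShape⟩ : tShape) ∉ A ∪ B := by rw [← hAB]; simp
    have hA0 := fun h => h0 (Or.inl h)
    have hB0 := fun h => h0 (Or.inr h)
    have he1 : IsLegEnd 1 := Or.inl rfl
    have he2 : IsLegEnd (-1) := Or.inr (Or.inl rfl)
    have he3 : IsLegEnd Complex.I := Or.inr (Or.inr rfl)
    have h1 : (⟨1, he1.mem⟩ : tShape) ∈ A ∪ B := by rw [← hAB]; simp
    have h2 : (⟨-1, he2.mem⟩ : tShape) ∈ A ∪ B := by rw [← hAB]; simp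
    have h3 : (⟨Complex.I, he3.mem⟩ : tShape) ∈ A ∪ B := by rw [← hAB]; simp
    have n12 : (1 : ℂ) ≠ -1 := by norm_num
    have n13 : (1 : ℂ) ≠ Complex.I := fun h => by simpa using congrArg Complex.re h
    have n23 : (-1 : ℂ) ≠ Complex.I := fun h => by simpa using congrArg Complex.re h
    rcases h1 with h1 | h1 <;> rcases h2 with h2 | h2
    · exact n12 (he1.eq_of_mem_preconnected he2 hA hA0 h1 h2)
    · rcases h3 with h3 | h3
      · exact n13 (he1.eq_of_mem_preconnected he3 hA hA0 h1 h3)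
      · exact n23 (he2.eq_of_mem_preconnected he3 hB hB0 h2 h3)
    · rcases h3 with h3 | h3
      · exact n23 (he2.eq_of_mem_preconnected he3 hA hA0 h2 h3)
      · exact n13 (he1.eq_of_mem_preconnected he3 hB hB0 h1 h3)
    · exact n12 (he1.eq_of_mem_preconnected he2 hB hB0 h1 h2)
  · intro h
    by_contra hz
    obtain ⟨e, he, hpos⟩ := exists_legCoord_pos z.2 fun h' => hz (Subtype.ext h')
    exact h ⟨_, _, isPreconnected_legCoord_lt _ hpos, he.isPreconnected_gt hpos, he.compl_singleton z hpos⟩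

theorem image_compl_singleton {K : Type*} [TopologicalSpace K] (φ : K ≃ₜ K) (z : K) :
    φ '' {z}ᶜ = {φ z}ᶜ := by
  rw [Set.image_compl_eq φ.bijective, Set.image_singleton]

theorem homeomorph_zero (φ : tShape ≃ₜ tShape) :
    φ ⟨0, zero_mem_tShape⟩ = ⟨0, zero_mem_tShape⟩ := by
  rw [eq_zero_iff_not_exists_preconnected]
  rintro ⟨A, B, hA, hB, hAB⟩
  refine (eq_zero_iff_not_exists_preconnected ⟨0, zero_mem_tShape⟩).mp rfl
    ⟨φ.symm '' A, φ.symm '' B, hA.image _ φ.symm.continuous.continuousOn,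
      hB.image _ φ.symm.continuous.continuousOn, ?_⟩
  rw [← Set.image_union, ← hAB, image_compl_singleton, φ.symm_apply_apply]

/-- The endpoints of the legs are the points whose complement is preconnected. -/
theorem isLegEnd_iff_isPreconnected (z : tShape) :
    IsLegEnd z ↔ IsPreconnected ({z}ᶜ : Set tShape) := by
  constructor
  · intro he
    have h1 : ({z}ᶜ : Set tShape) = {w : tShape | legCoord z w < 1} := by
      rw [he.compl_singleton z (by rw [he.legCoord_self]; exact one_pos), he.legCoord_self,
        Set.union_eq_left]
      exact fun w hw => absurd (he.legCoord_le_one w.2) (not_le.mpr hw)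
    rw [h1]
    exact isPreconnected_legCoord_lt _ one_pos
  · intro h
    by_contra hz
    have hz0 : z ≠ ⟨0, zero_mem_tShape⟩ := fun h0 =>
      (eq_zero_iff_not_exists_preconnected z).mp h0 ⟨_, _, h, h, (Set.union_self _).symm⟩
    obtain ⟨e, he, hpos⟩ := exists_legCoord_pos z.2 fun h' => hz0 (Subtype.ext h')
    have hlt : legCoord e z < 1 := lt_of_le_of_ne (he.legCoord_le_one z.2) fun h1 => hz (by
      rw [he.eq_mul_of_pos z.2 hpos, h1]; simpa using he)
    have hc : Continuous fun w : tShape => legCoord e w :=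
      (continuous_legCoord e).comp continuous_subtype_val
    obtain ⟨w, -, hw1, hw2⟩ := h {w : tShape | legCoord e w < legCoord e z}
      {w : tShape | legCoord e z < legCoord e w}
      (isOpen_lt hc continuous_const) (isOpen_lt continuous_const hc)
      (he.compl_singleton z hpos).subset
      ⟨⟨0, zero_mem_tShape⟩, fun h => hz0 h.symm, by simpa [legCoord_zero] using hpos⟩
      ⟨⟨e, he.mem⟩, fun h => hz (h ▸ he), by simpa [he.legCoord_self] using hlt⟩
    exact lt_asymm (show legCoord e w < legCoord e z from hw1) hw2

theorem homeomorph_isLegEnd (φ : tShape ≃ₜ tShape) {z : tShape} (hz : IsLegEnd z) :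
    IsLegEnd (φ z) := by
  rw [isLegEnd_iff_isPreconnected] at hz ⊢
  rw [← image_compl_singleton]
  exact hz.image _ φ.continuous.continuousOn

end Homeomorphisms

/-! ### Reparametrizing a leg -/

section LegMaps

/-- The functions that reparametrize a leg, identified with `[0, 1]`, and fix the negative half
line pointwise. -/
structure IsLegReparam (κ : ℝ → ℝ) : Prop where
  continuous : Continuous κ
  eq_self : ∀ t ≤ 0, κ t = t
  nonneg : ∀ t, 0 ≤ t → 0 ≤ κ t
  le_one : ∀ t ≤ 1, κ t ≤ 1

variable {e : ℂ} {κ : ℝ → ℝ}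

/-- The self-map of the T-shape that reparametrizes the leg ending at `e` by `κ`. -/
noncomputable def legMap (he : IsLegEnd e) (hκ : IsLegReparam κ) : C(tShape, tShape) where
  -- One formula serves the whole T-shape: the other legs have nonpositive coordinate, where `κ` is
  -- the identity and the correction vanishes.
  toFun z := ⟨z + ((κ (legCoord e z) - legCoord e z : ℝ) : ℂ) * e, by
    rcases le_or_gt (legCoord e z) 0 with h | h
    · rw [hκ.eq_self _ h, sub_self, Complex.ofReal_zero, zero_mul, add_zero]
      exact z.2
    · have h1 := he.mul_mem (hκ.nonneg _ h.le) (hκ.le_one _ (he.legCoord_le_one z.2))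
      have h2 := he.eq_mul_of_pos z.2 h
      convert h1 using 1
      conv_lhs => enter [1]; rw [h2]
      push_cast
      ring⟩
  continuous_toFun := by
    have h1 : Continuous fun z : tShape => legCoord e z :=
      (continuous_legCoord e).comp continuous_subtype_val
    have h2 := hκ.continuous.comp h1
    refine Continuous.subtype_mk (continuous_subtype_val.add (Continuous.mul ?_ continuous_const)) _
    exact Complex.continuous_ofReal.comp (h2.sub h1)

theorem legMap_coe (he : IsLegEnd e) (hκ : IsLegReparam κ) (z : tShape) :
    (legMap he hκ z : ℂ) = z + ((κ (legCoord e z) - legCoord e z : ℝ) : ℂ) * e := rfl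

theorem legCoord_legMap (he : IsLegEnd e) (hκ : IsLegReparam κ) (z : tShape) :
    legCoord e (legMap he hκ z) = κ (legCoord e z) := by
  rw [legMap_coe, he.legCoord_add_mul]
  ring

theorem legMap_eq_self (he : IsLegEnd e) (hκ : IsLegReparam κ) {z : tShape}
    (h : κ (legCoord e z) = legCoord e z) : legMap he hκ z = z := by
  apply Subtype.ext
  rw [legMap_coe, h]
  simp

theorem legMap_of_nonpos (he : IsLegEnd e) (hκ : IsLegReparam κ) {z : tShape}
    (h : legCoord e z ≤ 0) : legMap he hκ z = z :=
  legMap_eq_self he hκ (hκ.eq_self _ h)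

theorem legMap_of_pos (he : IsLegEnd e) (hκ : IsLegReparam κ) {z : tShape}
    (h : 0 < legCoord e z) : (legMap he hκ z : ℂ) = κ (legCoord e z) * e := by
  have h2 := he.eq_mul_of_pos z.2 h
  rw [legMap_coe]
  conv_lhs => enter [1]; rw [h2]
  push_cast
  ring

theorem isLegReparam_orderIso (θ : ℝ ≃o ℝ) (hθ : ∀ t, t ≤ 0 ∨ 1 ≤ t → θ t = t) :
    IsLegReparam θ where
  continuous := θ.continuous
  eq_self t ht := hθ t (Or.inl ht)
  nonneg t ht := by simpa [hθ 0 (Or.inl le_rfl)] using θ.monotone ht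
  le_one t ht := by simpa [hθ 1 (Or.inr le_rfl)] using θ.monotone ht

theorem orderIso_symm_eq_self (θ : ℝ ≃o ℝ) (hθ : ∀ t, t ≤ 0 ∨ 1 ≤ t → θ t = t) (t : ℝ)
    (ht : t ≤ 0 ∨ 1 ≤ t) : θ.symm t = t := by
  rw [OrderIso.symm_apply_eq, hθ t ht]

/-- The homeomorphism of the T-shape that reparametrizes the leg ending at `e`. -/
noncomputable def legHomeomorph (he : IsLegEnd e) (θ : ℝ ≃o ℝ)
    (hθ : ∀ t, t ≤ 0 ∨ 1 ≤ t → θ t = t) : tShape ≃ₜ tShape where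
  toFun := legMap he (isLegReparam_orderIso θ hθ)
  invFun := legMap he (isLegReparam_orderIso θ.symm (orderIso_symm_eq_self θ hθ))
  left_inv z := by
    apply Subtype.ext
    rw [legMap_coe, legCoord_legMap, legMap_coe, OrderIso.symm_apply_apply]
    push_cast
    ring
  right_inv z := by
    apply Subtype.ext
    rw [legMap_coe, legCoord_legMap, legMap_coe, OrderIso.apply_symm_apply]
    push_cast
    ring
  continuous_toFun := ContinuousMap.continuous _
  continuous_invFun := ContinuousMap.continuous _

theorem legCoord_legHomeomorph (he : IsLegEnd e) (θ : ℝ ≃o ℝ)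
    (hθ : ∀ t, t ≤ 0 ∨ 1 ≤ t → θ t = t) (z : tShape) :
    legCoord e (legHomeomorph he θ hθ z) = θ (legCoord e z) :=
  legCoord_legMap he (isLegReparam_orderIso θ hθ) z

theorem legCoord_legHomeomorph_symm (he : IsLegEnd e) (θ : ℝ ≃o ℝ)
    (hθ : ∀ t, t ≤ 0 ∨ 1 ≤ t → θ t = t) (z : tShape) :
    legCoord e ((legHomeomorph he θ hθ).symm z) = θ.symm (legCoord e z) :=
  legCoord_legMap he (isLegReparam_orderIso θ.symm (orderIso_symm_eq_self θ hθ)) z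

/-- Supplies the sliding maps: `t ≤ θ t` makes orbits monotone, and `θ α' = β'` pushes the interval
`(α', β')` off itself in one step. -/
theorem exists_orderIso {α α' β' β : ℝ} (h1 : α < α') (h2 : α' < β') (h3 : β' < β) :
    ∃ θ : ℝ ≃o ℝ, (∀ t, t ≤ α ∨ β ≤ t → θ t = t) ∧ (∀ t, t ≤ θ t) ∧ θ α' = β' := by
  set m := (β' - α) / (α' - α)
  set m' := (β - β') / (β - α')
  have hα : 0 < α' - α := by linarith
  have hβ : 0 < β - α' := by linarith
  have hm : 1 ≤ m := by rw [one_le_div hα]; linarith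
  have hm'0 : 0 < m' := div_pos (by linarith) hβ
  have hm' : m' ≤ 1 := by rw [div_le_one hβ]; linarith
  have e1 : m * (α' - α) = β' - α := div_mul_cancel₀ _ hα.ne'
  have e2 : m' * (β - α') = β - β' := div_mul_cancel₀ _ hβ.ne'
  -- The two lines join `(α, α)` and `(β, β)` to `(α', β')`; the maximum with `t` restores the
  -- identity outside `[α, β]`.
  let f : ℝ → ℝ := fun t => max t (min (α + m * (t - α)) (β + m' * (t - β)))
  have hle : ∀ t, t ≤ f t := fun t => le_max_left _ _
  have hfix : ∀ t, t ≤ α ∨ β ≤ t → f t = t := by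
    rintro t (h | h)
    · exact max_eq_left ((min_le_left _ _).trans (by nlinarith))
    · exact max_eq_left ((min_le_right _ _).trans (by nlinarith))
  have hmono : StrictMono f := by
    intro x y h
    refine max_lt_max h (min_lt_min ?_ ?_) <;> nlinarith
  have hcont : Continuous f := by fun_prop
  have hsurj : Function.Surjective f := by
    refine hcont.surjective (tendsto_atTop_mono hle tendsto_id) (tendsto_id.congr' ?_)
    filter_upwards [eventually_le_atBot α] with t ht
    exact (hfix t (Or.inl ht)).symm
  refine ⟨hmono.orderIsoOfSurjective f hsurj, hfix, hle, ?_⟩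
  change max α' (min (α + m * (α' - α)) (β + m' * (α' - β))) = β'
  have e3 : β + m' * (α' - β) = β' := by linear_combination -e2
  rw [e1, e3, add_sub_cancel, min_self, max_eq_right h2.le]

end LegMaps

/-! ### Invariant polynomials ignore the interior of a leg -/

section Invariance

variable {K : Type*} [TopologicalSpace K] [CompactSpace K]

theorem IsInvariant.comp_homeomorph {P : C(K, ℂ) → ℂ} (hP : IsInvariant (compositionGroup K) P)
    (φ : K ≃ₜ K) (f : C(K, ℂ)) : P (f.comp (φ : C(K, K))) = P f :=
  hP (compositionOperator K φ) ⟨φ, rfl⟩ f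

variable {P : C(tShape, ℂ) → ℂ} {e : ℂ}

/-- An invariant polynomial does not see a perturbation that lives on a part of an open leg where
the function is constant. -/
theorem eq_of_bump (hc : IsContinuousPolynomial P) (hi : IsInvariant (compositionGroup tShape) P)
    (he : IsLegEnd e) {α α' β' β : ℝ} (h0 : 0 ≤ α) (h1 : α < α') (h2 : α' < β') (h3 : β' < β)
    (h4 : β ≤ 1) (v d : C(tShape, ℂ)) (a : ℂ)
    (hv : ∀ z : tShape, α < legCoord e z → legCoord e z < β → v z = a)
    (hd : ∀ z : tShape, legCoord e z ≤ α' ∨ β' ≤ legCoord e z → d z = 0) : P (v + d) = P v := by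
  obtain ⟨θ, hθ, hle, hθα⟩ := exists_orderIso h1 h2 h3
  have hθ' : ∀ t, t ≤ 0 ∨ 1 ≤ t → θ t = t := fun t ht =>
    hθ t (ht.imp (fun h => h.trans h0) (fun h => h4.trans h))
  set φ := legHomeomorph he θ hθ'
  have hθ2 : ∀ t, α < t → t < β → α < θ t ∧ θ t < β := fun t ht ht' =>
    ⟨ht.trans_le (hle t), (θ.strictMono ht').trans_eq (hθ β (Or.inr le_rfl))⟩
  let F : C(tShape, ℂ) → C(tShape, ℂ) := fun f => f.comp (φ : C(tShape, tShape))
  have hFv : F v = v := by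
    ext z
    change v (φ z) = v z
    by_cases hz : α < legCoord e z ∧ legCoord e z < β
    · rw [hv z hz.1 hz.2]
      have := hθ2 _ hz.1 hz.2
      apply hv <;> rw [legCoord_legHomeomorph]
      exacts [this.1, this.2]
    · congr 1
      refine legMap_eq_self he (isLegReparam_orderIso θ hθ') (hθ _ ?_)
      by_contra! h
      exact hz h
  have hcoord : ∀ (i : ℕ) (z : tShape), legCoord e (φ^[i] z) = θ^[i] (legCoord e z) := by
    intro i z
    induction i with
    | zero => rfl
    | succ i ih =>
      rw [Function.iterate_succ_apply', Function.iterate_succ_apply', ← ih]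
      exact legCoord_legHomeomorph _ _ _ _
  have hFi : ∀ (i : ℕ) (z : tShape), (F^[i] d) z = d (φ^[i] z) := by
    intro i
    induction i with
    | zero => exact fun z => rfl
    | succ i ih =>
      intro z
      rw [Function.iterate_succ_apply', Function.iterate_succ_apply, ← ih]
      rfl
  -- Once an orbit is beyond `α'`, the next step takes it to `β'` or further, and it never comes
  -- back: the translates of `d` have disjoint supports.
  have hdisj : ∀ (z : tShape) (i j : ℕ), i < j → (F^[i] d) z ≠ 0 → (F^[j] d) z = 0 := by
    intro z i j hij hi
    rw [hFi] at hi ⊢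
    have hi' : α' < legCoord e (φ^[i] z) := by
      by_contra! h
      exact hi (hd _ (Or.inl h))
    apply hd
    right
    rw [hcoord] at hi' ⊢
    have hmono : Monotone fun n => θ^[n] (legCoord e z) :=
      monotone_nat_of_le_succ fun n => by
        rw [Function.iterate_succ_apply']
        exact hle _
    calc β' = θ α' := hθα.symm
      _ ≤ θ (θ^[i] (legCoord e z)) := θ.monotone hi'.le
      _ = θ^[i + 1] (legCoord e z) := (Function.iterate_succ_apply' _ _ _).symm
      _ ≤ _ := hmono hij
  refine hc.eq_of_bounded v (fun i => F^[i] d) ‖d‖ (fun N s hs => ?_) fun i t => ?_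
  · refine (ContinuousMap.norm_le _ (norm_nonneg d)).mpr fun z => ?_
    rw [ContinuousMap.sum_apply]
    by_cases hz : ∃ i ∈ range N, (F^[i] d) z ≠ 0
    · obtain ⟨i, hiN, hiz⟩ := hz
      rw [sum_eq_single_of_mem i hiN]
      · rw [ContinuousMap.smul_apply, norm_smul, hFi]
        exact (mul_le_of_le_one_left (norm_nonneg _) (hs i)).trans (d.norm_coe_le_norm _)
      · intro j _ hji
        rw [ContinuousMap.smul_apply]
        rcases hji.lt_or_gt with h | h
        · by_contra hne
          exact hiz (hdisj z j i h fun h0 => hne (by rw [h0, smul_zero]))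
        · rw [hdisj z i j h hiz, smul_zero]
    · push Not at hz
      rw [sum_eq_zero fun i hi => by rw [ContinuousMap.smul_apply, hz i hi, smul_zero], norm_zero]
      exact norm_nonneg d
  · induction i with
    | zero => rfl
    | succ i ih =>
      rw [← ih, ← hi.comp_homeomorph φ (v + t • F^[i] d)]
      congr 1
      conv_lhs => rw [← hFv]
      rw [Function.iterate_succ_apply']
      rfl

/-- Two functions that are constant near the ends of a leg and agree outside its middle part are
not distinguished by an invariant polynomial. -/
theorem eq_of_flat (hc : IsContinuousPolynomial P) (hi : IsInvariant (compositionGroup tShape) P)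
    (he : IsLegEnd e) {α β : ℝ} (h0 : 0 < α) (h1 : α < β) (h2 : β < 1) {f f' : C(tShape, ℂ)}
    {a b : ℂ} (hff' : ∀ z : tShape, legCoord e z ≤ α → f z = f' z)
    (ha : ∀ z : tShape, 0 < legCoord e z → legCoord e z ≤ α → f z = a)
    (hb : ∀ z : tShape, β ≤ legCoord e z → f z = b) (hb' : ∀ z : tShape, β ≤ legCoord e z → f' z = b) :
    P f = P f' := by
  -- Any target for `α` strictly between `β` and 1 would do. Then `y` makes its transition from `a`
  -- to `b` before `α`, and `x` makes its own after `β`.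
  obtain ⟨θ, hθ, hle, hθα⟩ := exists_orderIso h0 (h1.trans (show β < (β + 1) / 2 by linarith))
    (show (β + 1) / 2 < 1 by linarith)
  set φ := legHomeomorph he θ hθ
  have hφ : ∀ z : tShape, legCoord e (φ z) = θ (legCoord e z) := legCoord_legHomeomorph he θ hθ
  have hφ' : ∀ z : tShape, legCoord e (φ.symm z) = θ.symm (legCoord e z) :=
    legCoord_legHomeomorph_symm he θ hθ
  have hle' : ∀ t, θ.symm t ≤ t := fun t => by simpa using hle (θ.symm t)
  have hθ0 : θ.symm 0 = 0 := orderIso_symm_eq_self θ hθ 0 (Or.inl le_rfl)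
  have hpos : ∀ t, 0 < t → 0 < θ.symm t := fun t ht => hθ0.symm.trans_lt (θ.symm.strictMono ht)
  have hφ0 : ∀ z : tShape, legCoord e z ≤ 0 → φ z = z := fun z hz =>
    legMap_of_nonpos he (isLegReparam_orderIso θ hθ) hz
  have hφ0' : ∀ z : tShape, legCoord e z ≤ 0 → φ.symm z = z := fun z hz =>
    legMap_of_nonpos he (isLegReparam_orderIso θ.symm (orderIso_symm_eq_self θ hθ)) hz
  set y := f.comp (φ : C(tShape, tShape))
  set x := f'.comp (φ.symm : C(tShape, tShape))
  have hy : ∀ z : tShape, y z = f (φ z) := fun z => rfl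
  have hx : ∀ z : tShape, x z = f' (φ.symm z) := fun z => rfl
  -- The function `x + y - f` is reached in two ways: `y - f` is a bump where `x` is still `a`, and
  -- `x - f` is a bump where `y` is already `b`.
  have hPx : P (x + (y - f)) = P x := by
    refine eq_of_bump hc hi he le_rfl (hpos α h0) ((hle' α).trans_lt h1)
      (show β < (β + 1) / 2 by linarith) (by linarith) x (y - f) a (fun z hz hz' => ?_) ?_
    · have h3 : θ.symm (legCoord e z) ≤ α := by
        rw [← hθα] at hz'
        exact (θ.symm_apply_le.mpr hz'.le)
      rw [hx, ← hff' _ (by rwa [hφ']), ha _ (by rw [hφ']; exact hpos _ hz) (by rwa [hφ'])]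
    · rintro z (hz | hz) <;> rw [ContinuousMap.sub_apply, hy, sub_eq_zero]
      · rcases le_or_gt (legCoord e z) 0 with h | h
        · rw [hφ0 z h]
        · rw [ha z h (hz.trans (hle' α)), ha]
          · rw [hφ]
            exact h.trans_le (hle _)
          · rw [hφ]
            exact (θ.le_symm_apply).mp hz
      · rw [hb z hz, hb]
        rw [hφ]
        exact hz.trans (hle _)
  have hPy : P (y + (x - f)) = P y := by
    refine eq_of_bump hc hi he (hpos β (h0.trans h1)).le (α' := α) (β' := θ β) (β := 1) ?_
      (h1.trans_le (hle β)) ((θ.strictMono h2).trans_eq (hθ 1 (Or.inr le_rfl))) le_rfl y (x - f) b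
      (fun z hz _ => ?_) ?_
    · rw [θ.symm_apply_lt, hθα]
      linarith
    · rw [hy]
      apply hb
      rw [hφ]
      exact θ.symm_apply_le.mp hz.le
    · rintro z (hz | hz) <;> rw [ContinuousMap.sub_apply, hx, sub_eq_zero]
      · rcases le_or_gt (legCoord e z) 0 with h | h
        · rw [hφ0' z h, hff' z hz]
        · have h3 := (hle' _).trans hz
          rw [ha z h hz, ← hff' _ (by rwa [hφ']),
            ha _ (by rw [hφ']; exact hpos _ h) (by rwa [hφ'])]
      · rw [hb z ((hle β).trans hz), hb']
        rw [hφ']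
        exact θ.le_symm_apply.mpr hz
  calc P f = P y := (hi.comp_homeomorph φ f).symm
    _ = P (y + (x - f)) := hPy.symm
    _ = P (x + (y - f)) := by congr 1; abel
    _ = P x := hPx
    _ = P f' := hi.comp_homeomorph φ.symm f'

/-- The function that is the identity on the negative half line and maps `[δ, 1 - δ]` affinely
onto `[0, 1]`. -/
noncomputable def flatten (δ t : ℝ) : ℝ := min t 0 + max 0 (min 1 ((t - δ) / (1 - 2 * δ)))

theorem flatten_of_le {δ t : ℝ} (h1 : δ < 1 / 2) (ht : t ≤ δ) : flatten δ t = min t 0 := by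
  have : (t - δ) / (1 - 2 * δ) ≤ 0 := div_nonpos_of_nonpos_of_nonneg (by linarith) (by linarith)
  rw [flatten, max_eq_left ((min_le_right _ _).trans this), add_zero]

theorem flatten_of_ge {δ t : ℝ} (h0 : 0 < δ) (h1 : δ < 1 / 2) (ht : 1 - δ ≤ t) : flatten δ t = 1 := by
  have : 1 ≤ (t - δ) / (1 - 2 * δ) := by rw [one_le_div (by linarith)]; linarith
  rw [flatten, min_eq_left this, min_eq_right (by linarith), max_eq_right zero_le_one, zero_add]

theorem isLegReparam_flatten {δ : ℝ} (h0 : 0 < δ) (h1 : δ < 1 / 2) : IsLegReparam (flatten δ) where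
  continuous := by unfold flatten; fun_prop
  eq_self t ht := by rw [flatten_of_le h1 (ht.trans h0.le), min_eq_left ht]
  nonneg t ht := by
    rw [flatten, min_eq_right ht, zero_add]
    exact le_max_left _ _
  le_one t _ := by
    have h3 : max 0 (min 1 ((t - δ) / (1 - 2 * δ))) ≤ 1 := max_le zero_le_one (min_le_left _ _)
    have h4 : min t 0 ≤ 0 := min_le_right _ _
    unfold flatten
    linarith

theorem abs_flatten_sub_le {δ t : ℝ} (h0 : 0 < δ) (h1 : δ < 1 / 2) (ht : t ≤ 1) : |flatten δ t - t| ≤ δ := by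
  rw [abs_le]
  rcases le_or_gt t δ with h | h
  · rw [flatten_of_le h1 h]
    rcases le_total t 0 with h' | h'
    · rw [min_eq_left h']; constructor <;> linarith
    · rw [min_eq_right h']; constructor <;> linarith
  · rcases le_or_gt (1 - δ) t with h' | h'
    · rw [flatten_of_ge h0 h1 h']; constructor <;> linarith
    · have hp : 0 < 1 - 2 * δ := by linarith
      have h3 : (t - δ) / (1 - 2 * δ) ≤ 1 := by rw [div_le_one hp]; linarith
      have h4 : 0 ≤ (t - δ) / (1 - 2 * δ) := div_nonneg (by linarith) hp.le
      rw [flatten, min_eq_right (by linarith), min_eq_right h3, max_eq_right h4, zero_add,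
        div_sub' hp.ne', le_div_iff₀ hp, div_le_iff₀ hp]
      constructor <;> nlinarith

/-- Flattening moves points by at most `δ n`, and `f` is uniformly continuous on the compact
T-shape. -/
theorem tendsto_comp_flatten (he : IsLegEnd e) {δ : ℕ → ℝ} (h0 : ∀ n, 0 < δ n)
    (h1 : ∀ n, δ n < 1 / 2) (hδ : Tendsto δ atTop (𝓝 0)) (f : C(tShape, ℂ)) :
    Tendsto (fun n => f.comp (legMap he (isLegReparam_flatten (h0 n) (h1 n)))) atTop (𝓝 f) := by
  rw [ContinuousMap.tendsto_iff_tendstoUniformly, Metric.tendstoUniformly_iff]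
  intro ε hε
  obtain ⟨η, hη, h⟩ := Metric.uniformContinuous_iff.mp
    (CompactSpace.uniformContinuous_of_continuous f.continuous) ε hε
  filter_upwards [hδ.eventually (gt_mem_nhds hη)] with n hn z
  refine h ?_
  rw [dist_comm, Subtype.dist_eq, Complex.dist_eq, legMap_coe, add_sub_cancel_left, norm_mul,
    Complex.norm_real, Real.norm_eq_abs]
  have hnorm : ‖e‖ = 1 := by rcases he with rfl | rfl | rfl <;> simp
  rw [hnorm, mul_one]
  exact (abs_flatten_sub_le (h0 n) (h1 n) (he.legCoord_le_one z.2)).trans_lt hn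

/-- The value of an invariant polynomial does not depend on the values of the function inside a
leg. -/
theorem eq_of_eq_off_leg (hc : IsContinuousPolynomial P)
    (hi : IsInvariant (compositionGroup tShape) P) (he : IsLegEnd e) {f f' : C(tShape, ℂ)}
    (hoff : ∀ z : tShape, legCoord e z ≤ 0 → f z = f' z) (hend : f ⟨e, he.mem⟩ = f' ⟨e, he.mem⟩) :
    P f = P f' := by
  let δ : ℕ → ℝ := fun n => 1 / ((n : ℝ) + 1) * (1 / 3)
  have h0 : ∀ n, 0 < δ n := fun n => by positivity
  have h1 : ∀ n, δ n < 1 / 2 := fun n => by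
    have : 1 / ((n : ℝ) + 1) ≤ 1 := by
      rw [div_le_one (by positivity)]
      linarith [n.cast_nonneg (α := ℝ)]
    change 1 / ((n : ℝ) + 1) * (1 / 3) < 1 / 2
    linarith
  have hδ : Tendsto δ atTop (𝓝 0) := by
    simpa [δ] using (tendsto_one_div_add_atTop_nhds_zero_nat (𝕜 := ℝ)).mul_const 3⁻¹
  have hlim := fun k : C(tShape, ℂ) =>
    (hc.continuous.tendsto k).comp (tendsto_comp_flatten he h0 h1 hδ k)
  refine tendsto_nhds_unique (hlim f) ((hlim f').congr fun n => ?_)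
  have hκ := isLegReparam_flatten (h0 n) (h1 n)
  have hzero : ∀ z : tShape, 0 < legCoord e z → legCoord e z ≤ δ n →
      legMap he hκ z = ⟨0, zero_mem_tShape⟩ := fun z hz hz' => Subtype.ext (by
    rw [legMap_of_pos he hκ hz, flatten_of_le (h1 n) hz', min_eq_right hz.le]
    simp)
  have hone : ∀ z : tShape, 1 - δ n ≤ legCoord e z → legMap he hκ z = ⟨e, he.mem⟩ := fun z hz =>
    Subtype.ext (by
      have := h1 n
      rw [legMap_of_pos he hκ (by linarith), flatten_of_ge (h0 n) (h1 n) hz]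
      simp)
  refine (eq_of_flat hc hi he (h0 n) (show δ n < 1 - δ n by linarith [h1 n])
    (show 1 - δ n < 1 by linarith [h0 n]) (a := f ⟨0, zero_mem_tShape⟩) (b := f ⟨e, he.mem⟩)
    (fun z hz => ?_) (fun z hz hz' => ?_) (fun z hz => ?_) (fun z hz => ?_)).symm
  · refine hoff _ ?_
    rw [legCoord_legMap, flatten_of_le (h1 n) hz]
    exact min_le_right _ _
  · rw [ContinuousMap.comp_apply, hzero z hz hz']
  · rw [ContinuousMap.comp_apply, hone z hz]
  · rw [ContinuousMap.comp_apply, hone z hz, hend]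

theorem isLegReparam_min_zero : IsLegReparam fun t => min t 0 where
  continuous := by fun_prop
  eq_self _ ht := min_eq_left ht
  nonneg _ ht := le_min ht le_rfl
  le_one _ _ := (min_le_right _ _).trans zero_le_one

/-- A function can be replaced on a leg by the affine interpolation of its values at the ends. -/
theorem exists_norm_le_one_on_leg (he : IsLegEnd e) (g : C(tShape, ℂ))
    (hg0 : ‖g ⟨0, zero_mem_tShape⟩‖ ≤ 1) (hge : ‖g ⟨e, he.mem⟩‖ ≤ 1) :
    ∃ g' : C(tShape, ℂ), (∀ z : tShape, legCoord e z ≤ 0 → g' z = g z) ∧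
      g' ⟨e, he.mem⟩ = g ⟨e, he.mem⟩ ∧ ∀ z : tShape, 0 < legCoord e z → ‖g' z‖ ≤ 1 := by
  set g₀ := g ⟨0, zero_mem_tShape⟩
  set g₁ := g ⟨e, he.mem⟩
  let g' : C(tShape, ℂ) := g.comp (legMap he isLegReparam_min_zero) +
    ⟨fun z => ((max (legCoord e z) 0 : ℝ) : ℂ) * (g₁ - g₀), by
      have : Continuous fun z : tShape => legCoord e z :=
        (continuous_legCoord e).comp continuous_subtype_val
      fun_prop⟩
  have hoff : ∀ z : tShape, legCoord e z ≤ 0 → g' z = g z := by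
    intro z hz
    change g (legMap he _ z) + ((max (legCoord e z) 0 : ℝ) : ℂ) * (g₁ - g₀) = g z
    rw [legMap_of_nonpos he _ hz, max_eq_right hz, Complex.ofReal_zero, zero_mul, add_zero]
  have hon : ∀ z : tShape, 0 < legCoord e z → g' z = g₀ + legCoord e z * (g₁ - g₀) := by
    intro z hz
    change g (legMap he _ z) + ((max (legCoord e z) 0 : ℝ) : ℂ) * (g₁ - g₀) = _
    have : legMap he isLegReparam_min_zero z = ⟨0, zero_mem_tShape⟩ := Subtype.ext (by
      rw [legMap_of_pos he _ hz, min_eq_right hz.le]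
      simp)
    rw [this, max_eq_left hz.le]
  refine ⟨g', hoff, ?_, fun z hz => ?_⟩
  · rw [hon _ (by simp [he.legCoord_self])]
    simp [he.legCoord_self]
  · have h1 := he.legCoord_le_one z.2
    have h2 : g' z = ((1 - legCoord e z : ℝ) : ℂ) * g₀ + (legCoord e z : ℂ) * g₁ := by
      rw [hon z hz]
      push_cast
      ring
    rw [h2]
    refine (norm_add_le _ _).trans ?_
    rw [norm_mul, norm_mul, Complex.norm_real, Complex.norm_real, Real.norm_of_nonneg hz.le,
      Real.norm_of_nonneg (sub_nonneg.mpr h1)]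
    nlinarith

/-- If `g` is bounded by `1` at the centre and the endpoints, then some function in the unit ball
is not distinguished from `g` by any invariant polynomial. -/
theorem exists_mem_closedBall_eq (g : C(tShape, ℂ)) (hg0 : ‖g ⟨0, zero_mem_tShape⟩‖ ≤ 1)
    (hge : ∀ z : tShape, IsLegEnd z → ‖g z‖ ≤ 1) :
    ∃ g' ∈ Metric.closedBall (0 : C(tShape, ℂ)) 1, ∀ P : C(tShape, ℂ) → ℂ,
      IsContinuousPolynomial P → IsInvariant (compositionGroup tShape) P → P g' = P g := by
  have step : ∀ {e : ℂ} (he : IsLegEnd e) (g : C(tShape, ℂ)), ‖g ⟨0, zero_mem_tShape⟩‖ ≤ 1 →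
      (∀ z : tShape, IsLegEnd z → ‖g z‖ ≤ 1) → ∃ g' : C(tShape, ℂ),
      (‖g' ⟨0, zero_mem_tShape⟩‖ ≤ 1 ∧ ∀ z : tShape, IsLegEnd z → ‖g' z‖ ≤ 1) ∧
      (∀ z : tShape, legCoord e z ≤ 0 → g' z = g z) ∧ (∀ z : tShape, 0 < legCoord e z → ‖g' z‖ ≤ 1) ∧
      ∀ P : C(tShape, ℂ) → ℂ, IsContinuousPolynomial P →
        IsInvariant (compositionGroup tShape) P → P g' = P g := by
    intro e he g h0 h1
    obtain ⟨g', hoff, hend, hon⟩ := exists_norm_le_one_on_leg he g h0 (h1 _ he)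
    refine ⟨g', ⟨?_, fun z hz => ?_⟩, hoff, hon, fun P hc hi => eq_of_eq_off_leg hc hi he hoff hend⟩
    · rwa [hoff _ (legCoord_zero e).le]
    · rcases le_or_gt (legCoord e z) 0 with h | h
      · rw [hoff z h]
        exact h1 z hz
      · exact hon z h
  have he1 : IsLegEnd 1 := Or.inl rfl
  have he2 : IsLegEnd (-1) := Or.inr (Or.inl rfl)
  have he3 : IsLegEnd Complex.I := Or.inr (Or.inr rfl)
  obtain ⟨g1, ⟨a1, b1⟩, -, on1, P1⟩ := step he1 g hg0 hge
  obtain ⟨g2, ⟨a2, b2⟩, off2, on2, P2⟩ := step he2 g1 a1 b1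
  obtain ⟨g3, ⟨a3, b3⟩, off3, on3, P3⟩ := step he3 g2 a2 b2
  refine ⟨g3, ?_, fun P hc hi => by rw [P3 P hc hi, P2 P hc hi, P1 P hc hi]⟩
  rw [mem_closedBall_zero_iff, ContinuousMap.norm_le _ zero_le_one]
  intro z
  -- The bound on each open leg comes from the replacement made on that leg; later replacements do
  -- not change it there.
  rcases le_or_gt (legCoord Complex.I z) 0 with h3 | h3
  · rcases le_or_gt (legCoord (-1) z) 0 with h2 | h2
    · rcases le_or_gt (legCoord 1 z) 0 with h1 | h1
      · have hz : z = ⟨0, zero_mem_tShape⟩ := Subtype.ext (by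
          by_contra hne
          obtain ⟨e, rfl | rfl | rfl, hpos⟩ := exists_legCoord_pos z.2 hne <;> linarith)
        rwa [hz]
      · rw [off3 z h3, off2 z h2]
        exact on1 z h1
    · rw [off3 z h3]
      exact on2 z h2
  · exact on3 z h3

end Invariance
end InvariantPolynomials


/-! ### The separation criterion -/

theorem mainTheorem6 (g : C(InvariantPolynomials.tShape, ℂ))
    (hg : g ∉ Metric.closedBall (0 : C(InvariantPolynomials.tShape, ℂ)) 1) :
    (∃ P : C(InvariantPolynomials.tShape, ℂ) → ℂ,
      InvariantPolynomials.IsContinuousPolynomial P ∧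
      InvariantPolynomials.IsInvariant
        (InvariantPolynomials.compositionGroup InvariantPolynomials.tShape) P ∧
      InvariantPolynomials.Separates P g
        (Metric.closedBall (0 : C(InvariantPolynomials.tShape, ℂ)) 1)) ↔
    1 < max (max ‖g ⟨0, InvariantPolynomials.zero_mem_tShape⟩‖
              ‖g ⟨1, InvariantPolynomials.one_mem_tShape⟩‖)
          (max ‖g ⟨-1, InvariantPolynomials.neg_one_mem_tShape⟩‖
              ‖g ⟨Complex.I, InvariantPolynomials.I_mem_tShape⟩‖) := by
  constructor
  · rintro ⟨P, hc, hi, hsep⟩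
    by_contra! hle
    simp only [max_le_iff] at hle
    obtain ⟨⟨h0, h1⟩, h2, h3⟩ := hle
    obtain ⟨g', hg', hP⟩ := InvariantPolynomials.exists_mem_closedBall_eq g h0 (by
      rintro ⟨z, hz⟩ (rfl | rfl | rfl)
      exacts [h1, h2, h3])
    refine lt_irrefl _ (hsep.trans_le ?_)
    rw [← hP P hc hi]
    exact le_iSup₂ (f := fun w (_ : w ∈ Metric.closedBall (0 : C(_, ℂ)) 1) => ‖P w‖ₑ) g' hg'
  · intro h
    let ends : Finset InvariantPolynomials.tShape :=
      {⟨1, InvariantPolynomials.one_mem_tShape⟩, ⟨-1, InvariantPolynomials.neg_one_mem_tShape⟩,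
        ⟨Complex.I, InvariantPolynomials.I_mem_tShape⟩}
    have hends : ∀ z : InvariantPolynomials.tShape, z ∈ ends ↔ InvariantPolynomials.IsLegEnd z := fun z => by
      simp [ends, InvariantPolynomials.IsLegEnd, Subtype.ext_iff]
    have key : ∀ z : InvariantPolynomials.tShape, InvariantPolynomials.IsLegEnd z → 1 < ‖g z‖ → _ :=
      fun z hz h => InvariantPolynomials.exists_separating_of_invariant_finset ends
        (fun φ w hw => (hends _).mpr
          (InvariantPolynomials.homeomorph_isLegEnd φ ((hends w).mp hw))) g ((hends z).mpr hz) h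
    rcases lt_max_iff.mp h with h | h <;> rcases lt_max_iff.mp h with h | h
    · refine InvariantPolynomials.exists_separating_of_invariant_finset
        {⟨0, InvariantPolynomials.zero_mem_tShape⟩} (fun φ z hz => ?_) g
        (Finset.mem_singleton_self _) h
      rw [Finset.mem_singleton] at hz ⊢
      rw [hz, InvariantPolynomials.homeomorph_zero]
    · exact key _ (Or.inl rfl) h
    · exact key _ (Or.inr (Or.inl rfl)) h
    · exact key _ (Or.inr (Or.inr rfl)) h
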